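/- Let $L\ge 1$ and let $X_1,\dots,X_L$ be independent real random variables, where $X_i$ follows the Pearson type III distribution with parameters $(a_i,b_i,m_i)$: $a_i$ is a positive integer, $b_i\neq 0$, $m_i\in\mathbb R$, and $X_i$ has the density $$f(x;a_i,b_i,m_i)=\frac{|b_i|}{\Gamma(a_i)}\,\bigl(b_i(x-m_i)\bigr)^{a_i-1}e^{-b_i(x-m_i)}$$ on $(m_i,\infty)$ if $b_i>0$ and on $(-\infty,m_i)$ if $b_i<0$ (and $0$ elsewhere). Assume that either $b_i>0$ for all $i$ or $b_i<0$ for all $i$. Put $SX_L=\sum_{i=1}^L X_i$, $sa_L=\sum_{i=1}^L a_i$ and $sm_L=\sum_{i=1}^L m_i$. For $a>0$, $b\ne0$, $m\in\mathbb R$ let $$F(x;a,b,m)=\begin{cases}\Gamma\bigl(a,b(x-m)\bigr)/\Gamma(a), & b<0,\ x<m,\\ 1, & b<0,\ x\ge m,\\ \gamma\bigl(a,b(x-m)\bigr)/\Gamma(a), & b>0,\ x>m,\\ 0, & b>0,\ x\le m,\end{cases} \qquad \mu^n(a,b,m)=\sum_{l=0}^n\binom nl\frac{m^{n-l}\,\Gamma(l+a)}{b^l\,\Gamma(a)},$$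 where $\Gamma(a,z)=\int_z^\infty t^{a-1}e^{-t}\,dt$ and $\gamma(a,z)=\int_0^z t^{a-1}e^{-t}\,dt$; these are the CDF and the $n$-th moment of the Pearson type III distribution. If the $b_i$ are pairwise distinct, define for $1\le i\le L$ and $1\le k\le a_i$ $$\Xi_L^0(i,k)=\sum_{a_i=j_0\ge j_1\ge\cdots\ge j_{L-2}\ge j_{L-1}=k}(-1)^{sa_L-a_i}\,\frac{\prod_{w=1}^L b_w^{a_w}}{b_i^{k}}\prod_{s=1}^{L-1}\frac{(j_{s-1}+a_{c(s)}-j_s-1)!}{(a_{c(s)}-1)!\,(j_{s-1}-j_s)!}\,\bigl(b_i-b_{c(s)}\bigr)^{j_s-j_{s-1}-a_{c(s)}},$$ where the sum is over integer sequences $(j_0,\dots,j_{L-1})$ with the stated endpoints, and $c(s)=s$ for $s<i$, $c(s)=s+1$ for $s\ge i$ (so $c(1),\dots,c(L-1)$ are the indices different from $i$, in increasing order). For $L=1$ this reads $\Xi_1^0(1,a_1)=1$ and $\Xi_1^0(1,k)=0$ for $k<a_1$. Then for every $x\in\mathbb R$ $$\Pr(SX_L\le x)=\begin{cases}F(x;sa_L,b,sm_L),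 & b_i=b\ \text{for all } i,\\[2pt] \displaystyle\sum_{i=1}^L\sum_{k=1}^{a_i}\Xi_L^0(i,k)\,F(x;k,b_i,sm_L), & b_i\ne b_j\ \text{for all } i\ne j,\end{cases}$$ and for every integer $n\ge0$ the $n$-th moment of $SX_L$ exists (that is, $SX_L^n$ is integrable) and $$\mathbb E\bigl[SX_L^n\bigr]=\begin{cases}\mu^n(sa_L,b,sm_L), & b_i=b\ \text{for all } i,\\[2pt] \displaystyle\sum_{i=1}^L\sum_{k=1}^{a_i}\Xi_L^0(i,k)\,\mu^n(k,b_i,sm_L), & b_i\ne b_j\ \text{for all } i\ne j.\end{cases}$$ -/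

import Mathlib

open MeasureTheory ProbabilityTheory

noncomputable section

/-- Density of the Pearson type III distribution with shape `a`, inverse scale `b` and shift `m`.
It is supported on `(m, ∞)` if `b > 0` and on `(-∞, m)` if `b < 0`, that is, where
`b * (x - m) > 0`. -/
def pearsonPDF (a b m x : ℝ) : ℝ :=
  if 0 < b * (x - m) then
    |b| / Real.Gamma a * (b * (x - m)) ^ (a - 1) * Real.exp (-(b * (x - m)))
  else 0

/-- The Pearson type III distribution with parameters `(a, b, m)`. -/
def pearsonMeasure (a b m : ℝ) : Measure ℝ :=
  volume.withDensity fun x => ENNReal.ofReal (pearsonPDF a b m x)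

/-- Lower incomplete gamma function `γ(a, z)`, for `z ≥ 0`. -/
def lowerGamma (a z : ℝ) : ℝ :=
  ∫ t in Set.Ioc 0 z, t ^ (a - 1) * Real.exp (-t)

/-- Upper incomplete gamma function `Γ(a, z)`, for `z ≥ 0`. -/
def upperGamma (a z : ℝ) : ℝ :=
  ∫ t in Set.Ioi z, t ^ (a - 1) * Real.exp (-t)

/-- The closed form `F_X(x, a, b, m)` of the Pearson type III CDF. On the support the maximum is
`b * (x - m)`; off the support it is `0`, so that the value is `0` for `b > 0`, `x ≤ m` and `1` for
`b < 0`, `x ≥ m`. -/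
def pearsonCDF (a b m x : ℝ) : ℝ :=
  if b < 0 then upperGamma a (max 0 (b * (x - m))) / Real.Gamma a
  else lowerGamma a (max 0 (b * (x - m))) / Real.Gamma a

/-- The closed form of the `n`-th moment of the Pearson type III distribution. -/
def pearsonMoment (n : ℕ) (a b m : ℝ) : ℝ :=
  ∑ l ∈ Finset.range (n + 1),
    (n.choose l : ℝ) * (m ^ (n - l) * Real.Gamma (l + a) / (b ^ l * Real.Gamma a))

/-- The summation indices of the weight `Ξ⁰` for `L = N + 1` variables: all integer sequences
`top = j 0 ≥ j 1 ≥ ⋯ ≥ j (L - 1) = k`. The free entries are `j 1, …, j (L - 2)`, so summing over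
this set is the nested sum `∑_{j₁ = k}^{top} ∑_{j₂ = k}^{j₁} ⋯ ∑_{j_{L-2} = k}^{j_{L-3}}`. -/
def descendingChains (N top k : ℕ) : Finset (Fin (N + 1) → ℕ) :=
  (Fintype.piFinset fun _ => Finset.Icc k top).filter fun j =>
    j 0 = top ∧ j (Fin.last N) = k ∧ ∀ s : Fin N, j s.succ ≤ j s.castSucc

/-- The weight `Ξ⁰_L(i, k, a, b)` for `L = N + 1` variables. As `s` runs through `0, …, L - 2`,
`i.succAbove s` runs through the indices other than `i` in increasing order: in 1-based numbering
it is `s + U(s - i)`, `U` being the Heaviside step function with `U(0) = 1`. -/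
def Xi0 {N : ℕ} (i : Fin (N + 1)) (k : ℕ) (a : Fin (N + 1) → ℕ) (b : Fin (N + 1) → ℝ) : ℝ :=
  ∑ j ∈ descendingChains N (a i) k,
    (-1) ^ ((∑ w, a w) - a i) * ((∏ w, b w ^ a w) / b i ^ k) *
      ∏ s : Fin N,
        ((j s.castSucc + a (i.succAbove s) - j s.succ - 1).factorial : ℝ) /
            (((a (i.succAbove s) - 1).factorial : ℝ) *
              ((j s.castSucc - j s.succ).factorial : ℝ)) *
          (b i - b (i.succAbove s)) ^
            ((j s.succ : ℤ) - (j s.castSucc : ℤ) - (a (i.succAbove s) : ℤ))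

end

/-!
The Pearson type III law with integer shape `a` has characteristic function
`(b / (b - it)) ^ a * exp (imt)`, so that of the sum is `∏ i, (b i / (b i - it)) ^ a i` times
`exp (it ∑ i, m i)`. With a common `b` this is again of Pearson type. With distinct `b i` the
product is expanded into partial fractions in `it`: up to a constant, the coefficient of the `k`-th
power of the pole at `b i` is a Taylor coefficient at `b i` of the product of the other factors, and
expanding that product one factor at a time produces the chains in `Ξ⁰`. By injectivity of the
characteristic function the law of the sum is a signed mixture of Pearson laws, and integrating
indicators and powers against it gives the distribution function and the moments.
-/

section PartialFractions

open Polynomial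

lemma X_pow_dvd_trunc_mul_sub_one {R : Type*} [CommRing R] {E : PowerSeries R} {f : R[X]}
    (h : E * f = 1) (n : ℕ) : X ^ n ∣ E.trunc n * f - 1 := by
  refine X_pow_dvd_iff.2 fun d hd => ?_
  rw [coeff_sub, ← Polynomial.coeff_coe, Polynomial.coe_mul,
    PowerSeries.coeff_mul_eq_coeff_trunc_mul_trunc _ _ hd, PowerSeries.trunc_trunc,
    ← PowerSeries.coeff_mul_eq_coeff_trunc_mul_trunc _ _ hd, h, ← Polynomial.coe_one,
    Polynomial.coeff_coe, sub_self]

lemma X_sub_C_pow_dvd_taylor_trunc_mul_sub_one {R : Type*} [CommRing R] {E : PowerSeries R}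
    {f : R[X]} {r : R} (h : E * (taylor r f : R[X]) = 1) (n : ℕ) :
    (X - C r) ^ n ∣ taylor (-r) (E.trunc n) * f - 1 := by
  have hshift := map_dvd (taylorAlgHom (-r)) (X_pow_dvd_trunc_mul_sub_one h n)
  simpa [taylor_taylor, sub_eq_add_neg] using hshift

variable {ι K : Type*} [Fintype ι] [DecidableEq ι] [Field K]

/-- The Taylor expansion at `r i` of `∏ j ≠ i, (X - r j)⁻¹ ^ a j`, the cofactor of the pole `r i`
in `∏ j, (X - r j)⁻¹ ^ a j`. The variable of the power series stands for `X - r i`. -/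
noncomputable def cofactorExpansion (r : ι → K) (a : ι → ℕ) (i : ι) : PowerSeries K :=
  ∏ j ∈ {i}ᶜ, ((PowerSeries.X - PowerSeries.C (r j - r i)) ^ a j)⁻¹

lemma cofactorExpansion_mul_taylor {r : ι → K} (hr : Function.Injective r) (a : ι → ℕ) (i : ι) :
    cofactorExpansion r a i * (taylor (r i) (∏ j ∈ {i}ᶜ, (X - C (r j)) ^ a j) : K[X]) = 1 := by
  have htaylor : ((taylor (r i) (∏ j ∈ {i}ᶜ, (X - C (r j)) ^ a j) : K[X]) : PowerSeries K) =
      ∏ j ∈ {i}ᶜ, (PowerSeries.X - PowerSeries.C (r j - r i)) ^ a j := by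
    rw [← taylorAlgHom_apply, map_prod, ← Polynomial.coeToPowerSeries.ringHom_apply, map_prod]
    refine Finset.prod_congr rfl fun j _ => ?_
    simp only [taylorAlgHom_apply, map_sub, taylor_X, taylor_C, map_pow,
      Polynomial.coeToPowerSeries.ringHom_apply, Polynomial.coe_add,
      Polynomial.coe_X, Polynomial.coe_C]
    ring
  rw [htaylor, cofactorExpansion, ← Finset.prod_mul_distrib]
  refine Finset.prod_eq_one fun j hj => PowerSeries.inv_mul_cancel _ ?_
  simpa using pow_ne_zero (a j)
    (neg_ne_zero.2 (sub_ne_zero.2 (hr.ne (by simpa using hj : j ≠ i))))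

lemma degree_taylor_trunc_mul_prod_lt (E : PowerSeries K) (r : ι → K) (a : ι → ℕ) (i : ι) :
    (taylor (-r i) (E.trunc (a i)) * ∏ j ∈ {i}ᶜ, (X - C (r j)) ^ a j).degree <
      ((∑ j, a j : ℕ) : WithBot ℕ) := by
  have hcofactor : (∏ j ∈ {i}ᶜ, (X - C (r j)) ^ a j).degree =
      ((∑ j ∈ {i}ᶜ, a j : ℕ) : WithBot ℕ) := by
    simp [degree_prod]
  rw [degree_mul, degree_taylor, hcofactor, Fintype.sum_eq_add_sum_compl i, Nat.cast_add]
  exact WithBot.add_lt_add_right WithBot.coe_ne_bot (PowerSeries.degree_trunc_lt _ _)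

lemma prod_X_sub_C_pow_dvd_sum_taylor_trunc_sub_one {r : ι → K} (hr : Function.Injective r)
    (a : ι → ℕ) :
    ∏ i, (X - C (r i)) ^ a i ∣
      ∑ i, taylor (-r i) ((cofactorExpansion r a i).trunc (a i)) *
        ∏ j ∈ {i}ᶜ, (X - C (r j)) ^ a j - 1 := by
  refine Fintype.prod_dvd_of_coprime (fun i j hij => ?_) fun i => ?_
  · exact (isCoprime_X_sub_C_of_isUnit_sub (sub_ne_zero.2 (hr.ne hij)).isUnit).pow
  · rw [Fintype.sum_eq_add_sum_compl i, add_sub_right_comm]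
    refine dvd_add (X_sub_C_pow_dvd_taylor_trunc_mul_sub_one
      (cofactorExpansion_mul_taylor hr a i) _) (Finset.dvd_sum fun j hj => ?_)
    have hij : i ∈ ({j}ᶜ : Finset ι) := by simpa [eq_comm] using hj
    exact (Finset.dvd_prod_of_mem (fun l => (X - C (r l)) ^ a l) hij).mul_left _

lemma sum_taylor_trunc_cofactorExpansion_mul_prod {r : ι → K} (hr : Function.Injective r)
    {a : ι → ℕ} (ha : 0 < ∑ i, a i) :
    ∑ i, taylor (-r i) ((cofactorExpansion r a i).trunc (a i)) *
      ∏ j ∈ {i}ᶜ, (X - C (r j)) ^ a j = 1 := by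
  have hmonic : (∏ i, (X - C (r i)) ^ a i).Monic :=
    monic_prod_of_monic _ _ fun i _ => (monic_X_sub_C _).pow _
  have hdegree : (∏ i, (X - C (r i)) ^ a i).degree = ((∑ i, a i : ℕ) : WithBot ℕ) := by
    simp [degree_prod]
  by_contra hne
  refine hmonic.not_dvd_of_degree_lt (sub_ne_zero.2 hne) ?_
    (prod_X_sub_C_pow_dvd_sum_taylor_trunc_sub_one hr a)
  rw [hdegree]
  refine (degree_sub_le _ _).trans_lt (max_lt ((degree_sum_le _ _).trans_lt ?_) ?_)
  · exact (Finset.sup_lt_iff (WithBot.bot_lt_coe _)).2 fun i _ =>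
      degree_taylor_trunc_mul_prod_lt _ r a i
  · rw [degree_one]
    exact_mod_cast ha

lemma aeval_taylor_trunc {R A : Type*} [CommRing R] [CommRing A] [Algebra R A]
    (E : PowerSeries R) (r : R) (n : ℕ) (x : A) :
    aeval x (taylor (-r) (E.trunc n)) =
      ∑ k ∈ Finset.Icc 1 n,
        algebraMap R A (E.coeff (n - k)) * (x - algebraMap R A r) ^ (n - k) := by
  rw [taylor_apply, aeval_comp, aeval_def, PowerSeries.eval₂_trunc_eq_sum_range]
  rw [map_neg, ← sub_eq_add_neg, map_sub, aeval_X, aeval_C]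
  refine Finset.sum_nbij' (n - ·) (n - ·) ?_ ?_ ?_ ?_ ?_ <;>
    simp only [Finset.mem_range, Finset.mem_Icc] <;> intro l hl
  any_goals omega
  rw [Nat.sub_sub_self hl.le]

theorem prod_inv_sub_pow_eq_sum {L : Type*} [Field L] [Algebra K L] {r : ι → K}
    (hr : Function.Injective r) {a : ι → ℕ} (ha : 0 < ∑ i, a i) {x : L}
    (hx : ∀ i, x - algebraMap K L (r i) ≠ 0) :
    ∏ i, (x - algebraMap K L (r i))⁻¹ ^ a i =
      ∑ i, ∑ k ∈ Finset.Icc 1 (a i),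
        algebraMap K L ((cofactorExpansion r a i).coeff (a i - k)) *
          (x - algebraMap K L (r i))⁻¹ ^ k := by
  have hone := congrArg (aeval x) (sum_taylor_trunc_cofactorExpansion_mul_prod hr ha)
  rw [map_sum, map_one] at hone
  rw [← mul_one (∏ i, _), ← hone, Finset.mul_sum]
  refine Finset.sum_congr rfl fun i _ => ?_
  have hcancel : (∏ j ∈ {i}ᶜ, (x - algebraMap K L (r j))⁻¹ ^ a j) *
      ∏ j ∈ {i}ᶜ, (x - algebraMap K L (r j)) ^ a j = 1 := by
    rw [← Finset.prod_mul_distrib]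
    exact Finset.prod_eq_one fun j _ => by rw [← mul_pow, inv_mul_cancel₀ (hx j), one_pow]
  rw [map_mul, aeval_taylor_trunc, map_prod, Fintype.prod_eq_mul_prod_compl i]
  simp only [map_pow, map_sub, aeval_X, aeval_C]
  rw [mul_mul_mul_comm, hcancel, mul_one, Finset.mul_sum]
  refine Finset.sum_congr rfl fun k hk => ?_
  rw [mul_left_comm]
  congr 1
  rw [pow_sub₀ _ (hx i) (Finset.mem_Icc.1 hk).2, ← mul_assoc, ← mul_pow, inv_mul_cancel₀ (hx i),
    one_pow, one_mul, inv_pow]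

end PartialFractions

section DescendingChains

lemma mem_descendingChains {N top k : ℕ} {j : Fin (N + 1) → ℕ} :
    j ∈ descendingChains N top k ↔ j 0 = top ∧ j (Fin.last N) = k ∧ Antitone j := by
  rw [Fin.antitone_iff_succ_le, descendingChains, Finset.mem_filter, and_iff_right_iff_imp,
    ← Fin.antitone_iff_succ_le, Fintype.mem_piFinset]
  rintro ⟨rfl, rfl, hj⟩ s
  exact Finset.mem_Icc.2 ⟨hj (Fin.le_last s), hj (Fin.zero_le s)⟩

lemma cons_mem_descendingChains {N top q k : ℕ} {j : Fin (N + 1) → ℕ} (hq : q ≤ top)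
    (hj : j ∈ descendingChains N q k) :
    (Fin.cons top j : Fin (N + 2) → ℕ) ∈ descendingChains (N + 1) top k := by
  obtain ⟨rfl, hlast, hanti⟩ := mem_descendingChains.1 hj
  refine mem_descendingChains.2 ⟨Fin.cons_zero _ _, ?_, ?_⟩
  · rwa [← Fin.succ_last, Fin.cons_succ]
  · refine Fin.antitone_iff_succ_le.2 (Fin.cases (by simpa using hq) fun s => ?_)
    simpa only [← Fin.succ_castSucc, Fin.cons_succ] using hanti s.castSucc_lt_succ.le

lemma tail_mem_descendingChains {N top k : ℕ} {j : Fin (N + 2) → ℕ}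
    (hj : j ∈ descendingChains (N + 1) top k) :
    j 1 ∈ Finset.Icc k top ∧ Fin.tail j ∈ descendingChains N (j 1) k := by
  obtain ⟨rfl, rfl, hanti⟩ := mem_descendingChains.1 hj
  exact ⟨Finset.mem_Icc.2 ⟨hanti (Fin.le_last 1), hanti (Fin.zero_le 1)⟩,
    mem_descendingChains.2 ⟨rfl, rfl, fun _ _ h => hanti (Fin.succ_le_succ_iff.2 h)⟩⟩

lemma sum_descendingChains_succ {M : Type*} [AddCommMonoid M] (N top k : ℕ)
    (F : (Fin (N + 2) → ℕ) → M) :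
    ∑ j ∈ descendingChains (N + 1) top k, F j =
      ∑ q ∈ Finset.Icc k top, ∑ j ∈ descendingChains N q k, F (Fin.cons top j) := by
  have hcons : ∀ j ∈ descendingChains (N + 1) top k, Fin.cons top (Fin.tail j) = j :=
    fun j hj => by rw [← (mem_descendingChains.1 hj).1, Fin.cons_self_tail]
  rw [Finset.sum_sigma']
  refine Finset.sum_bij' (fun j _ => ⟨j 1, Fin.tail j⟩) (fun p _ => Fin.cons top p.2)
    (fun j hj => Finset.mem_sigma.2 (tail_mem_descendingChains hj)) ?_ hcons ?_ ?_
  · rintro ⟨q, j⟩ hp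
    obtain ⟨hq, hj⟩ := Finset.mem_sigma.1 hp
    exact cons_mem_descendingChains (Finset.mem_Icc.1 hq).2 hj
  · rintro ⟨_, j⟩ hp
    obtain ⟨rfl : j 0 = _, -⟩ := mem_descendingChains.1 (Finset.mem_sigma.1 hp).2
    rfl
  · exact fun j hj => congrArg F (hcons j hj).symm

lemma descendingChains_zero_self (k : ℕ) : descendingChains 0 k k = {fun _ => k} := by
  ext j
  simp [mem_descendingChains, funext_iff, Fin.forall_fin_one, Subsingleton.antitone]

lemma descendingChains_zero_of_ne {top k : ℕ} (h : top ≠ k) : descendingChains 0 top k = ∅ :=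
  Finset.eq_empty_of_forall_notMem fun j hj => by
    obtain ⟨htop, hk, -⟩ := mem_descendingChains.1 hj
    exact h (htop.symm.trans hk)

variable {R : Type*} [CommSemiring R]

lemma coeff_mul_eq_sum_Icc (f g : PowerSeries R) {k top : ℕ} (h : k ≤ top) :
    (f * g).coeff (top - k) =
      ∑ q ∈ Finset.Icc k top, f.coeff (top - q) * g.coeff (q - k) := by
  rw [PowerSeries.coeff_mul]
  refine Finset.sum_nbij' (k + ·.2) (fun q => (top - q, q - k)) ?_ ?_ ?_ ?_ ?_ <;>
    simp only [Finset.HasAntidiagonal.mem_antidiagonal, Finset.mem_Icc, Prod.forall, Prod.mk.injEq]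
  any_goals omega
  rintro p q hpq
  congr 3 <;> omega

lemma coeff_prod_eq_sum_descendingChains {N : ℕ} (f : Fin N → PowerSeries R) {k top : ℕ}
    (h : k ≤ top) :
    (∏ s, f s).coeff (top - k) =
      ∑ j ∈ descendingChains N top k, ∏ s : Fin N, (f s).coeff (j s.castSucc - j s.succ) := by
  induction N generalizing top with
  | zero =>
    rcases h.eq_or_lt with rfl | hlt
    · simp [descendingChains_zero_self]
    · simp [descendingChains_zero_of_ne hlt.ne', PowerSeries.coeff_one, Nat.sub_ne_zero_of_lt hlt]
  | succ N ih =>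
    rw [sum_descendingChains_succ, Fin.prod_univ_succ, coeff_mul_eq_sum_Icc _ _ h]
    refine Finset.sum_congr rfl fun q hq => ?_
    rw [ih _ (Finset.mem_Icc.1 hq).1, Finset.mul_sum]
    refine Finset.sum_congr rfl fun j hj => ?_
    rw [Fin.prod_univ_succ]
    simp only [Fin.castSucc_zero, Fin.cons_zero, Fin.cons_succ, ← Fin.succ_castSucc,
      (mem_descendingChains.1 hj).1]

end DescendingChains

section Weights

lemma coeff_inv_X_sub_C_pow_succ {K : Type*} [Field K] {e : K} (he : e ≠ 0) (d n : ℕ) :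
    ((PowerSeries.X - PowerSeries.C e) ^ (d + 1))⁻¹.coeff n =
      (-1) ^ (d + 1) * ((d + n).choose d * (e⁻¹ ^ n * e⁻¹ ^ (d + 1))) := by
  have hgeom := congrArg (PowerSeries.rescale e⁻¹)
    (PowerSeries.mk_add_choose_mul_one_sub_pow_eq_one K d)
  rw [map_mul, map_pow, map_sub, map_one, PowerSeries.rescale_X] at hgeom
  have hfactor : PowerSeries.X - PowerSeries.C e =
      PowerSeries.C (-e) * (1 - PowerSeries.C e⁻¹ * PowerSeries.X) := by
    rw [mul_sub, ← mul_assoc, ← map_mul, neg_mul, mul_inv_cancel₀ he]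
    simp only [map_neg, map_one, mul_one, neg_mul, one_mul]
    ring
  have hinv : ((PowerSeries.X - PowerSeries.C e) ^ (d + 1))⁻¹ =
      PowerSeries.C ((-e)⁻¹ ^ (d + 1)) *
        PowerSeries.rescale e⁻¹ (PowerSeries.mk fun n => ((d + n).choose d : K)) := by
    rw [PowerSeries.inv_eq_iff_mul_eq_one (by simpa using he), hfactor, mul_pow, ← map_pow,
      mul_mul_mul_comm, ← map_mul, ← mul_pow, inv_mul_cancel₀ (neg_ne_zero.2 he), one_pow,
      map_one, one_mul, hgeom]
  rw [hinv, PowerSeries.coeff_C_mul, PowerSeries.coeff_rescale, PowerSeries.coeff_mk, inv_neg,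
    neg_pow]
  ring

lemma coeff_inv_X_sub_C_pow {K : Type*} [Field K] [CharZero K] {e : K} (he : e ≠ 0) {a : ℕ}
    (ha : 0 < a) (n : ℕ) :
    ((PowerSeries.X - PowerSeries.C e) ^ a)⁻¹.coeff n =
      (-1) ^ a * (((n + a - 1).factorial : K) / ((a - 1).factorial * n.factorial) *
        e ^ (-(n : ℤ) - a)) := by
  obtain ⟨d, rfl⟩ := Nat.exists_eq_succ_of_ne_zero ha.ne'
  have hexp : e ^ (-(n : ℤ) - (d + 1 : ℕ)) = e⁻¹ ^ n * e⁻¹ ^ (d + 1) := by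
    rw [← pow_add, ← zpow_natCast, inv_zpow', Nat.cast_add n, neg_add']
  rw [Nat.succ_eq_add_one, hexp, coeff_inv_X_sub_C_pow_succ he,
    Nat.cast_choose K (Nat.le_add_right d n), Nat.add_sub_cancel_left, Nat.add_sub_cancel,
    ← Nat.add_assoc, Nat.add_sub_cancel, Nat.add_comm n d]

variable {N : ℕ} {a : Fin (N + 1) → ℕ} {b : Fin (N + 1) → ℝ}

lemma cofactorExpansion_neg_eq_prod_succAbove {K : Type*} [Field K] (b : Fin (N + 1) → K)
    (a : Fin (N + 1) → ℕ) (i : Fin (N + 1)) :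
    cofactorExpansion (-b) a i = ∏ s, ((PowerSeries.X - PowerSeries.C (b i - b (i.succAbove s))) ^
      a (i.succAbove s))⁻¹ := by
  have hcompl : ({i}ᶜ : Finset (Fin (N + 1))) = Finset.univ.image i.succAbove := by
    ext j
    simp
  rw [cofactorExpansion, hcompl, Finset.prod_image Fin.succAbove_right_injective.injOn]
  simp only [Pi.neg_apply, neg_sub_neg]

lemma Xi0_eq_coeff_cofactorExpansion (ha : ∀ i, 0 < a i) (hb : Function.Injective b)
    {i : Fin (N + 1)} {k : ℕ} (hk : k ≤ a i) :
    Xi0 i k a b =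
      (∏ w, b w ^ a w) / b i ^ k * (cofactorExpansion (-b) a i).coeff (a i - k) := by
  rw [cofactorExpansion_neg_eq_prod_succAbove, coeff_prod_eq_sum_descendingChains _ hk,
    Finset.mul_sum, Xi0, Fin.sum_univ_succAbove a i, Nat.add_sub_cancel_left]
  refine Finset.sum_congr rfl fun j hj => ?_
  have hne : ∀ s, b i - b (i.succAbove s) ≠ 0 := fun s =>
    sub_ne_zero.2 (hb.ne (Fin.succAbove_ne i s).symm)
  simp only [coeff_inv_X_sub_C_pow (hne _) (ha _)]
  rw [← Finset.prod_pow_eq_pow_sum, mul_comm (∏ s, _), mul_assoc, ← Finset.prod_mul_distrib]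
  congr 1
  refine Finset.prod_congr rfl fun s _ => ?_
  have hs : j s.succ ≤ j s.castSucc := (mem_descendingChains.1 hj).2.2 s.castSucc_lt_succ.le
  rw [Nat.cast_sub hs, neg_sub, Nat.sub_add_comm hs]

lemma prod_div_add_pow_eq_sum_Xi0 (ha : ∀ i, 0 < a i) (hb : Function.Injective b)
    (hb0 : ∀ i, b i ≠ 0) {w : ℂ} (hw : ∀ i, (b i : ℂ) + w ≠ 0) :
    ∏ i, ((b i : ℂ) / (b i + w)) ^ a i =
      ∑ i, ∑ k ∈ Finset.Icc 1 (a i), (Xi0 i k a b : ℂ) * ((b i : ℂ) / (b i + w)) ^ k := by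
  have hroot : ∀ i, w - algebraMap ℝ ℂ ((-b) i) = b i + w := fun i => by simp [add_comm]
  have hfrac := prod_inv_sub_pow_eq_sum (L := ℂ) (r := -b) (neg_injective.comp hb)
    (Finset.sum_pos (fun i _ => ha i) Finset.univ_nonempty) (x := w) fun i => by
      simpa only [hroot] using hw i
  simp only [hroot] at hfrac
  simp only [div_eq_mul_inv, mul_pow, Finset.prod_mul_distrib, hfrac, Finset.mul_sum,
    Complex.coe_algebraMap]
  refine Finset.sum_congr rfl fun i _ => Finset.sum_congr rfl fun k hk => ?_
  have hbi : (b i : ℂ) ≠ 0 := Complex.ofReal_ne_zero.2 (hb0 i)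
  rw [Xi0_eq_coeff_cofactorExpansion ha hb (Finset.mem_Icc.1 hk).2]
  push_cast
  field_simp

end Weights

section GammaMeasure

open Set

variable {a r : ℝ}

lemma gammaMeasure_eq_withDensity_restrict (a r : ℝ) :
    gammaMeasure a r = (volume.restrict (Ioi 0)).withDensity fun x =>
      ENNReal.ofReal (r ^ a / Real.Gamma a * (x ^ (a - 1) * Real.exp (-(r * x)))) := by
  rw [Measure.restrict_congr_set Ioi_ae_eq_Ici, ← withDensity_indicator measurableSet_Ici,
    gammaMeasure]
  congr 1 with x
  by_cases hx : 0 ≤ x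
  · rw [gammaPDF_of_nonneg hx, indicator_of_mem (mem_Ici.2 hx), mul_assoc]
  · rw [gammaPDF_of_neg (not_le.1 hx), indicator_of_notMem (mt mem_Ici.1 hx)]

lemma gammaDensity_nonneg (ha : 0 < a) (hr : 0 < r) {x : ℝ} (hx : 0 < x) :
    0 ≤ r ^ a / Real.Gamma a * (x ^ (a - 1) * Real.exp (-(r * x))) := by
  have := Real.Gamma_pos_of_pos ha
  positivity

variable {E : Type*} [NormedAddCommGroup E] [NormedSpace ℝ E]

lemma integral_gammaMeasure (ha : 0 < a) (hr : 0 < r) (f : ℝ → E) :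
    ∫ x, f x ∂(gammaMeasure a r) =
      (r ^ a / Real.Gamma a) • ∫ x in Ioi 0, (x ^ (a - 1) * Real.exp (-(r * x))) • f x := by
  rw [gammaMeasure_eq_withDensity_restrict,
    integral_withDensity_eq_integral_toReal_smul₀ (by fun_prop)
      (.of_forall fun _ => ENNReal.ofReal_lt_top), ← integral_smul]
  refine setIntegral_congr_fun measurableSet_Ioi fun x hx => ?_
  rw [ENNReal.toReal_ofReal (gammaDensity_nonneg ha hr hx), mul_smul]

lemma integrable_gammaMeasure_iff (ha : 0 < a) (hr : 0 < r) {f : ℝ → E} :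
    Integrable f (gammaMeasure a r) ↔
      IntegrableOn (fun x => (x ^ (a - 1) * Real.exp (-(r * x))) • f x) (Ioi 0) := by
  have hconst : r ^ a / Real.Gamma a ≠ 0 :=
    (div_pos (Real.rpow_pos_of_pos hr a) (Real.Gamma_pos_of_pos ha)).ne'
  rw [gammaMeasure_eq_withDensity_restrict,
    integrable_withDensity_iff_integrable_smul₀' (by fun_prop)
      (.of_forall fun _ => ENNReal.ofReal_lt_top),
    IntegrableOn,
    ← integrable_smul_iff hconst fun x => (x ^ (a - 1) * Real.exp (-(r * x))) • f x]
  refine integrable_congr (ae_restrict_of_forall_mem measurableSet_Ioi fun x hx => ?_)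
  dsimp only [Pi.smul_apply]
  rw [ENNReal.toReal_ofReal (gammaDensity_nonneg ha hr hx), mul_smul]

lemma measureReal_gammaMeasure (ha : 0 < a) (hr : 0 < r) {s : Set ℝ} (hs : MeasurableSet s) :
    (gammaMeasure a r).real s =
      r ^ a / Real.Gamma a * ∫ x in Ioi 0 ∩ s, x ^ (a - 1) * Real.exp (-(r * x)) := by
  rw [← integral_indicator_one hs, integral_gammaMeasure ha hr, smul_eq_mul,
    ← setIntegral_indicator hs]
  congr 2 with x
  by_cases hx : x ∈ s <;> simp [hx]

lemma integral_pow_gammaMeasure (ha : 0 < a) (hr : 0 < r) (l : ℕ) :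
    ∫ x, x ^ l ∂(gammaMeasure a r) = Real.Gamma (l + a) / (r ^ l * Real.Gamma a) := by
  have hintegrand : ∀ x ∈ Ioi (0 : ℝ), (x ^ (a - 1) * Real.exp (-(r * x))) • x ^ l =
      x ^ (l + a - 1) * Real.exp (-(r * x)) := fun x hx => by
    rw [smul_eq_mul, mul_right_comm, ← Real.rpow_natCast x l, ← Real.rpow_add hx,
      sub_add_eq_add_sub, add_comm a]
  rw [integral_gammaMeasure ha hr, setIntegral_congr_fun measurableSet_Ioi hintegrand,
    Real.integral_rpow_mul_exp_neg_mul_Ioi (by positivity) hr, smul_eq_mul, one_div,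
    Real.inv_rpow hr.le, Real.rpow_add hr, Real.rpow_natCast]
  field_simp

lemma exp_mul_smul_gammaIntegrand (a r t x : ℝ) :
    (x ^ (a - 1) * Real.exp (-(r * x))) • Real.exp (t * x) =
      x ^ (a - 1) * Real.exp (-((r - t) * x)) := by
  rw [smul_eq_mul, mul_assoc, ← Real.exp_add]
  congr 2
  ring

lemma Iio_subset_integrableExpSet_gammaMeasure (ha : 0 < a) (hr : 0 < r) :
    Iio r ⊆ integrableExpSet id (gammaMeasure a r) := fun t ht => by
  have hrt : 0 < r - t := sub_pos.2 ht
  have := Real.Gamma_pos_of_pos ha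
  refine (integrable_gammaMeasure_iff ha hr).2 (.of_integral_ne_zero ?_)
  simp only [id_eq, exp_mul_smul_gammaIntegrand]
  rw [Real.integral_rpow_mul_exp_neg_mul_Ioi ha hrt]
  positivity

lemma Iio_subset_interior_integrableExpSet_gammaMeasure (ha : 0 < a) (hr : 0 < r) :
    Iio r ⊆ interior (integrableExpSet id (gammaMeasure a r)) :=
  interior_maximal (Iio_subset_integrableExpSet_gammaMeasure ha hr) isOpen_Iio

lemma memLp_id_gammaMeasure (ha : 0 < a) (hr : 0 < r) (p : NNReal) :
    MemLp id p (gammaMeasure a r) :=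
  memLp_of_mem_interior_integrableExpSet
    (Iio_subset_interior_integrableExpSet_gammaMeasure ha hr hr) p

lemma mgf_id_gammaMeasure (ha : 0 < a) (hr : 0 < r) {t : ℝ} (ht : t < r) :
    mgf id (gammaMeasure a r) t = (1 - t / r) ^ (-a) := by
  have hrt : 0 < r - t := sub_pos.2 ht
  have := Real.Gamma_pos_of_pos ha
  simp only [mgf, id_eq]
  rw [integral_gammaMeasure ha hr]
  simp only [exp_mul_smul_gammaIntegrand]
  rw [Real.integral_rpow_mul_exp_neg_mul_Ioi ha hrt, smul_eq_mul, one_sub_div hr.ne',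
    Real.rpow_neg (by positivity), Real.div_rpow hrt.le hr.le, one_div, Real.inv_rpow hrt.le]
  field_simp

lemma analyticOnNhd_one_sub_div_cpow (hr : 0 < r) (s : ℂ) :
    AnalyticOnNhd ℂ (fun z : ℂ => (1 - z / r) ^ s) {z | z.re < r} := fun z hz => by
  refine AnalyticAt.cpow (by fun_prop) analyticAt_const (.inl ?_)
  rw [Complex.sub_re, Complex.one_re, Complex.div_ofReal_re, sub_pos, div_lt_one hr]
  exact hz

/- Both sides are analytic on the half-plane and agree on its real points. -/
lemma complexMGF_id_gammaMeasure (ha : 0 < a) (hr : 0 < r) {z : ℂ} (hz : z.re < r) :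
    complexMGF id (gammaMeasure a r) z = (1 - z / r) ^ (-a : ℂ) := by
  have hanalytic : AnalyticOnNhd ℂ (complexMGF id (gammaMeasure a r)) {z | z.re < r} :=
    analyticOnNhd_complexMGF.mono fun z hz =>
      Iio_subset_interior_integrableExpSet_gammaMeasure ha hr hz
  have hreal : ∀ t < r, complexMGF id (gammaMeasure a r) t = (1 - t / r) ^ (-a : ℂ) :=
    fun t ht => by
      rw [complexMGF_ofReal, mgf_id_gammaMeasure ha hr ht,
        Complex.ofReal_cpow (sub_nonneg.2 ((div_le_one hr).2 ht.le))]
      push_cast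
      rfl
  have hfreq : ∃ᶠ t : ℝ in nhdsWithin 0 {0}ᶜ,
      complexMGF id (gammaMeasure a r) t = (1 - t / r) ^ (-a : ℂ) :=
    (((eventually_lt_nhds hr).filter_mono nhdsWithin_le_nhds).mono hreal).frequently
  have hofReal : Filter.Tendsto Complex.ofReal (nhdsWithin 0 {0}ᶜ)
      (nhdsWithin ((0 : ℝ) : ℂ) {((0 : ℝ) : ℂ)}ᶜ) :=
    Complex.continuous_ofReal.continuousWithinAt.tendsto_nhdsWithin
      fun _ => Complex.ofReal_injective.ne
  exact hanalytic.eqOn_of_preconnected_of_frequently_eq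
    (analyticOnNhd_one_sub_div_cpow hr _) (convex_halfSpace_re_lt r).isPreconnected
    (by simpa using hr) (hofReal.frequently hfreq) hz

lemma charFun_gammaMeasure (ha : 0 < a) (hr : 0 < r) (t : ℝ) :
    charFun (gammaMeasure a r) t = (1 - t * Complex.I / r) ^ (-a : ℂ) := by
  rw [← complexMGF_id_mul_I, complexMGF_id_gammaMeasure ha hr (by simpa using hr)]

end GammaMeasure

section PearsonMeasure

open Set

lemma map_withDensity_comp {α β : Type*} [MeasurableSpace α] [MeasurableSpace β] (μ : Measure α)
    {f : α → β} (hf : Measurable f) {g : β → ENNReal} (hg : Measurable g) :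
    (μ.withDensity (g ∘ f)).map f = (μ.map f).withDensity g := by
  ext s hs
  rw [Measure.map_apply hf hs, withDensity_apply _ (hf hs), withDensity_apply _ hs,
    setLIntegral_map hs hg hf]
  rfl

lemma map_mul_sub_smul_volume {b : ℝ} (hb : b ≠ 0) (m : ℝ) :
    (ENNReal.ofReal |b| • volume : Measure ℝ).map (fun x => b * (x - m)) = volume := by
  have hshift : (volume : Measure ℝ).map (fun x => x - m) = volume := by
    simpa only [sub_eq_add_neg] using map_add_right_eq_self (volume : Measure ℝ) (-m)
  rw [Measure.map_smul, ← Function.comp_def (fun x => b * x) (fun x => x - m),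
    ← Measure.map_map (by fun_prop) (by fun_prop), hshift, Real.smul_map_volume_mul_left hb]

variable {a b : ℝ}

lemma ofReal_pearsonPDF_of_ne (a : ℝ) (hb : b ≠ 0) {m x : ℝ} (hx : x ≠ m) :
    ENNReal.ofReal (pearsonPDF a b m x) = ENNReal.ofReal |b| * gammaPDF a 1 (b * (x - m)) := by
  have hne : b * (x - m) ≠ 0 := mul_ne_zero hb (sub_ne_zero.2 hx)
  rw [gammaPDF, ← ENNReal.ofReal_mul (abs_nonneg b), pearsonPDF, gammaPDFReal]
  simp only [hne.symm.le_iff_lt, Real.one_rpow, one_mul]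
  split_ifs
  · ring_nf
  · rw [mul_zero]

lemma pearsonMeasure_eq_withDensity_comp (a : ℝ) (hb : b ≠ 0) (m : ℝ) :
    pearsonMeasure a b m = (ENNReal.ofReal |b| • volume : Measure ℝ).withDensity
      (gammaPDF a 1 ∘ fun x => b * (x - m)) := by
  rw [pearsonMeasure, withDensity_smul_measure, ← withDensity_smul' _ _ ENNReal.ofReal_ne_top]
  refine withDensity_congr_ae ?_
  filter_upwards [Measure.ae_ne volume m] with x hx
  exact ofReal_pearsonPDF_of_ne a hb hx

lemma map_pearsonMeasure (a : ℝ) (hb : b ≠ 0) (m : ℝ) :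
    (pearsonMeasure a b m).map (fun x => b * (x - m)) = gammaMeasure a 1 := by
  have hmeas : Measurable (gammaPDF a 1) := (measurable_gammaPDFReal a 1).ennreal_ofReal
  rw [pearsonMeasure_eq_withDensity_comp a hb m, map_withDensity_comp _ (by fun_prop) hmeas,
    map_mul_sub_smul_volume hb, gammaMeasure]

lemma pearsonMeasure_eq_map (a : ℝ) (hb : b ≠ 0) (m : ℝ) :
    pearsonMeasure a b m = (gammaMeasure a 1).map fun y => b⁻¹ * y + m := by
  have hinv : (fun y => b⁻¹ * y + m) ∘ (fun x => b * (x - m)) = id := by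
    ext x
    simp [hb]
  rw [← map_pearsonMeasure a hb m, Measure.map_map (by fun_prop) (by fun_prop), hinv,
    Measure.map_id]

lemma isProbabilityMeasure_pearsonMeasure (ha : 0 < a) (hb : b ≠ 0) (m : ℝ) :
    IsProbabilityMeasure (pearsonMeasure a b m) := by
  have := isProbabilityMeasure_gammaMeasure ha one_pos
  rw [pearsonMeasure_eq_map a hb m]
  exact Measure.isProbabilityMeasure_map (by fun_prop)

lemma memLp_id_pearsonMeasure (ha : 0 < a) (hb : b ≠ 0) (m : ℝ) (p : NNReal) :
    MemLp id p (pearsonMeasure a b m) := by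
  have := isProbabilityMeasure_gammaMeasure ha one_pos
  rw [pearsonMeasure_eq_map a hb m, memLp_map_measure_iff (by fun_prop) (by fun_prop)]
  exact ((memLp_id_gammaMeasure ha one_pos p).const_mul b⁻¹).add (memLp_const m)

lemma integrable_pow_of_memLp {Ω : Type*} [MeasurableSpace Ω] {P : Measure Ω} [IsFiniteMeasure P]
    {X : Ω → ℝ} {n : ℕ} (hX : MemLp X n P) : Integrable (fun ω => X ω ^ n) P :=
  (integrable_norm_iff (hX.aestronglyMeasurable.pow n)).1 (by simpa using hX.integrable_norm_pow')

lemma integral_pow_pearsonMeasure (ha : 0 < a) (hb : b ≠ 0) (m : ℝ) (n : ℕ) :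
    ∫ x, x ^ n ∂(pearsonMeasure a b m) = pearsonMoment n a b m := by
  have := isProbabilityMeasure_gammaMeasure ha one_pos
  have hint : ∀ l : ℕ, Integrable (fun y : ℝ => y ^ l) (gammaMeasure a 1) := fun l =>
    integrable_pow_of_memLp (memLp_id_gammaMeasure ha one_pos l)
  rw [pearsonMeasure_eq_map a hb m, integral_map (by fun_prop) (by fun_prop), pearsonMoment]
  simp only [add_pow, mul_pow]
  rw [integral_finsetSum _ fun l _ => (((hint l).const_mul _).mul_const _).mul_const _]
  refine Finset.sum_congr rfl fun l _ => ?_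
  rw [integral_mul_const, integral_mul_const, integral_const_mul,
    integral_pow_gammaMeasure ha one_pos l, inv_pow, one_pow, one_mul]
  field_simp

lemma preimage_inv_mul_add_Iic_of_pos (hb : 0 < b) (m x : ℝ) :
    (fun y => b⁻¹ * y + m) ⁻¹' Iic x = Iic (b * (x - m)) := by
  ext y
  rw [mem_preimage, mem_Iic, mem_Iic, ← le_sub_iff_add_le, inv_mul_le_iff₀ hb]

lemma preimage_inv_mul_add_Iic_of_neg (hb : b < 0) (m x : ℝ) :
    (fun y => b⁻¹ * y + m) ⁻¹' Iic x = Ici (b * (x - m)) := by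
  ext y
  rw [mem_preimage, mem_Iic, mem_Ici, ← le_sub_iff_add_le, inv_mul_eq_div,
    div_le_iff_of_neg' hb]

lemma measureReal_Iic_gammaMeasure_one (ha : 0 < a) (z : ℝ) :
    (gammaMeasure a 1).real (Iic z) = lowerGamma a (max 0 z) / Real.Gamma a := by
  have hset : Ioi 0 ∩ Iic z = Ioc 0 (max 0 z) := by
    rcases le_total 0 z with hz | hz
    · rw [max_eq_right hz, Ioi_inter_Iic]
    · rw [max_eq_left hz, Ioi_inter_Iic, Ioc_eq_empty hz.not_gt, Ioc_self]
  simp only [measureReal_gammaMeasure ha one_pos measurableSet_Iic, hset, lowerGamma,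
    Real.one_rpow, one_mul, one_div_mul_eq_div]

lemma measureReal_Ici_gammaMeasure_one (ha : 0 < a) (z : ℝ) :
    (gammaMeasure a 1).real (Ici z) = upperGamma a (max 0 z) / Real.Gamma a := by
  have hset : (Ioi 0 ∩ Ici z : Set ℝ) =ᵐ[volume] Ioi (max 0 z) := by
    rw [← Ioi_inter_Ioi]
    exact (ae_eq_refl _).inter Ioi_ae_eq_Ici.symm
  rw [measureReal_gammaMeasure ha one_pos measurableSet_Ici, setIntegral_congr_set hset,
    upperGamma]
  simp only [Real.one_rpow, one_mul, one_div_mul_eq_div]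

lemma measureReal_Iic_pearsonMeasure (ha : 0 < a) (hb : b ≠ 0) (m x : ℝ) :
    (pearsonMeasure a b m).real (Iic x) = pearsonCDF a b m x := by
  rw [pearsonMeasure_eq_map a hb m, map_measureReal_apply (by fun_prop) measurableSet_Iic,
    pearsonCDF]
  rcases lt_or_gt_of_ne hb with hneg | hpos
  · rw [if_pos hneg, preimage_inv_mul_add_Iic_of_neg hneg, measureReal_Ici_gammaMeasure_one ha]
  · rw [if_neg hpos.not_gt, preimage_inv_mul_add_Iic_of_pos hpos,
      measureReal_Iic_gammaMeasure_one ha]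

lemma charFun_pearsonMeasure (ha : 0 < a) (hb : b ≠ 0) (m t : ℝ) :
    charFun (pearsonMeasure a b m) t =
      (1 - t * Complex.I / b) ^ (-a : ℂ) * Complex.exp (m * t * Complex.I) := by
  rw [pearsonMeasure_eq_map a hb m, ← Function.comp_def (· + m) (b⁻¹ * ·),
    ← Measure.map_map (by fun_prop) (by fun_prop), charFun_map_add_const, charFun_map_mul,
    charFun_gammaMeasure ha one_pos]
  congr 2
  · push_cast
    ring
  · simp [mul_comm]

lemma charFun_pearsonMeasure_natCast {n : ℕ} (hn : 0 < n) (hb : b ≠ 0) (m t : ℝ) :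
    charFun (pearsonMeasure n b m) t =
      ((b : ℂ) / (b + -(t * Complex.I))) ^ n * Complex.exp (m * t * Complex.I) := by
  have hb' : (b : ℂ) ≠ 0 := Complex.ofReal_ne_zero.2 hb
  rw [charFun_pearsonMeasure (Nat.cast_pos.2 hn) hb, Complex.ofReal_natCast, Complex.cpow_neg,
    Complex.cpow_natCast, ← inv_pow, one_sub_div hb', inv_div, sub_eq_add_neg]

end PearsonMeasure

section SignedMixtures

variable {ι F : Type*} [Fintype ι] [NormedAddCommGroup F] [NormedSpace ℝ F]

lemma integral_sum_smul_measure {α : Type*} [MeasurableSpace α] {ν : ι → Measure α}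
    (d : ι → NNReal) {f : α → F} (hf : ∀ i, Integrable f (ν i)) :
    ∫ x, f x ∂(∑ i, d i • ν i) = ∑ i, (d i : ℝ) • ∫ x, f x ∂(ν i) := by
  rw [integral_finsetSum_measure fun i _ => (hf i).smul_measure_nnreal]
  simp only [integral_smul_nnreal_measure, NNReal.smul_def]

variable {E : Type*} [NormedAddCommGroup E] [InnerProductSpace ℝ E] [MeasurableSpace E]
  [BorelSpace E] [SecondCountableTopology E]

lemma integrable_cexp_inner_mul_I (μ : Measure E) [IsFiniteMeasure μ] (t : E) :
    Integrable (fun x => Complex.exp (inner ℝ x t * Complex.I)) μ :=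
  .of_bound (by fun_prop) 1 (.of_forall fun x => (Complex.norm_exp_ofReal_mul_I _).le)

lemma charFun_add_measure (μ ν : Measure E) [IsFiniteMeasure μ] [IsFiniteMeasure ν] (t : E) :
    charFun (μ + ν) t = charFun μ t + charFun ν t :=
  integral_add_measure (integrable_cexp_inner_mul_I μ t) (integrable_cexp_inner_mul_I ν t)

lemma charFun_sum_smul_measure (ν : ι → Measure E) [∀ i, IsFiniteMeasure (ν i)] (d : ι → NNReal)
    (t : E) : charFun (∑ i, d i • ν i) t = ∑ i, ((d i : ℝ) : ℂ) * charFun (ν i) t := by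
  simp only [charFun_apply]
  rw [integral_finsetSum_measure fun i _ =>
    (integrable_cexp_inner_mul_I (ν i) t).smul_measure_nnreal]
  simp only [integral_smul_nnreal_measure, NNReal.smul_def, Complex.real_smul]

lemma add_sum_toNNReal_neg_smul_of_charFun_eq [CompleteSpace E] {μ : Measure E}
    [IsFiniteMeasure μ] {ν : ι → Measure E} [∀ i, IsFiniteMeasure (ν i)] {c : ι → ℝ}
    (h : ∀ t, charFun μ t = ∑ i, (c i : ℂ) * charFun (ν i) t) :
    μ + ∑ i, (-c i).toNNReal • ν i = ∑ i, (c i).toNNReal • ν i := by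
  refine Measure.ext_of_charFun (funext fun t => ?_)
  rw [charFun_add_measure, charFun_sum_smul_measure, charFun_sum_smul_measure, h,
    ← Finset.sum_add_distrib]
  refine Finset.sum_congr rfl fun i _ => ?_
  have hc : c i + (-c i).toNNReal = (c i).toNNReal := by
    rw [Real.coe_toNNReal', Real.coe_toNNReal']
    exact add_eq_of_eq_sub (max_zero_sub_eq_self (c i)).symm
  rw [← add_mul, ← Complex.ofReal_add, hc]

/- The negative weights are moved to the side of `μ`, which turns the hypothesis into an equality
of measures. -/
lemma integral_eq_sum_smul_of_charFun_eq [CompleteSpace E] {μ : Measure E} [IsFiniteMeasure μ]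
    {ν : ι → Measure E} [∀ i, IsFiniteMeasure (ν i)] {c : ι → ℝ}
    (h : ∀ t, charFun μ t = ∑ i, (c i : ℂ) * charFun (ν i) t) {f : E → F}
    (hf : ∀ i, Integrable f (ν i)) :
    ∫ x, f x ∂μ = ∑ i, c i • ∫ x, f x ∂(ν i) := by
  have hint (d : ι → NNReal) : Integrable f (∑ i, d i • ν i) :=
    integrable_finsetSum_measure.2 fun i _ => (hf i).smul_measure_nnreal
  have hμν := add_sum_toNNReal_neg_smul_of_charFun_eq h
  have hμ : Integrable f μ :=
    (hint fun i => (c i).toNNReal).mono_measure (hμν ▸ Measure.le_add_right le_rfl)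
  have hadd := integral_add_measure hμ (hint fun i => (-c i).toNNReal)
  rw [hμν, integral_sum_smul_measure _ hf, integral_sum_smul_measure _ hf] at hadd
  rw [eq_sub_of_add_eq hadd.symm, ← Finset.sum_sub_distrib]
  simp only [← sub_smul, Real.coe_toNNReal', max_zero_sub_eq_self]

end SignedMixtures

section Sums

open Set

lemma prod_cpow_eq_cpow_sum {ι : Type*} (s : Finset ι) {z : ℂ} (hz : z ≠ 0) (e : ι → ℂ) :
    ∏ i ∈ s, z ^ e i = z ^ ∑ i ∈ s, e i := by
  simp only [Complex.cpow_def_of_ne_zero hz, Finset.mul_sum, Complex.exp_sum]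

variable {Ω ι : Type*} [MeasurableSpace Ω] {P : Measure Ω} [Fintype ι]

lemma memLp_sum_of_hasLaw_pearsonMeasure {X : ι → Ω → ℝ} {a b m : ι → ℝ} (ha : ∀ i, 0 < a i)
    (hb : ∀ i, b i ≠ 0) (hX : ∀ i, HasLaw (X i) (pearsonMeasure (a i) (b i) (m i)) P)
    (p : NNReal) : MemLp (fun ω => ∑ i, X i ω) p P :=
  memLp_finsetSum Finset.univ fun i _ => by
    have hid := memLp_id_pearsonMeasure (ha i) (hb i) (m i) p
    rw [← (hX i).map_eq] at hid
    exact (memLp_map_measure_iff hid.aestronglyMeasurable (hX i).aemeasurable).1 hid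

lemma hasLaw_sum_pearsonMeasure [Nonempty ι] {X : ι → Ω → ℝ} {a m : ι → ℝ} {b : ℝ}
    (ha : ∀ i, 0 < a i) (hb : b ≠ 0) (hX : ∀ i, HasLaw (X i) (pearsonMeasure (a i) b (m i)) P)
    (hindep : iIndepFun X P) :
    HasLaw (fun ω => ∑ i, X i ω) (pearsonMeasure (∑ i, a i) b (∑ i, m i)) P where
  aemeasurable := Finset.aemeasurable_fun_sum _ fun i _ => (hX i).aemeasurable
  map_eq := by
    have hsum : 0 < ∑ i, a i := Finset.sum_pos (fun i _ => ha i) Finset.univ_nonempty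
    have := isProbabilityMeasure_pearsonMeasure hsum hb (∑ i, m i)
    have := hindep.isProbabilityMeasure
    refine Measure.ext_of_charFun (funext fun t => ?_)
    have hbase : 1 - t * Complex.I / b ≠ 0 := fun h => by simpa using congrArg Complex.re h
    rw [hindep.charFun_map_fun_sum_eq_prod fun i => (hX i).aemeasurable, Finset.prod_apply,
      charFun_pearsonMeasure hsum hb]
    simp only [(hX _).map_eq, charFun_pearsonMeasure (ha _) hb]
    rw [Finset.prod_mul_distrib, prod_cpow_eq_cpow_sum _ hbase, ← Complex.exp_sum]
    push_cast
    simp only [Finset.sum_neg_distrib, Finset.sum_mul]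

variable {N : ℕ} {X : Fin (N + 1) → Ω → ℝ} {a : Fin (N + 1) → ℕ} {b m : Fin (N + 1) → ℝ}

lemma charFun_map_sum_eq_sum_Xi0 (ha : ∀ i, 0 < a i) (hb : Function.Injective b)
    (hb0 : ∀ i, b i ≠ 0) (hX : ∀ i, HasLaw (X i) (pearsonMeasure (a i) (b i) (m i)) P)
    (hindep : iIndepFun X P) (t : ℝ) :
    charFun (P.map fun ω => ∑ i, X i ω) t = ∑ i, ∑ k ∈ Finset.Icc 1 (a i),
      (Xi0 i k a b : ℂ) * charFun (pearsonMeasure k (b i) (∑ q, m q)) t := by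
  have hpole : ∀ i, (b i : ℂ) + -(t * Complex.I) ≠ 0 := fun i h =>
    hb0 i (by simpa using congrArg Complex.re h)
  have := hindep.isProbabilityMeasure
  rw [hindep.charFun_map_fun_sum_eq_prod fun i => (hX i).aemeasurable, Finset.prod_apply]
  simp only [(hX _).map_eq, charFun_pearsonMeasure_natCast (ha _) (hb0 _)]
  rw [Finset.prod_mul_distrib, ← Complex.exp_sum, prod_div_add_pow_eq_sum_Xi0 ha hb hb0 hpole,
    Finset.sum_mul]
  refine Finset.sum_congr rfl fun i _ => ?_
  rw [Finset.sum_mul]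
  refine Finset.sum_congr rfl fun k hk => ?_
  rw [charFun_pearsonMeasure_natCast (Finset.mem_Icc.1 hk).1 (hb0 i), ← mul_assoc]
  push_cast
  simp only [Finset.sum_mul]

lemma integral_map_sum_eq_sum_Xi0_smul {F : Type*} [NormedAddCommGroup F] [NormedSpace ℝ F]
    (ha : ∀ i, 0 < a i) (hb : Function.Injective b) (hb0 : ∀ i, b i ≠ 0)
    (hX : ∀ i, HasLaw (X i) (pearsonMeasure (a i) (b i) (m i)) P) (hindep : iIndepFun X P)
    {f : ℝ → F}
    (hf : ∀ i, ∀ k ∈ Finset.Icc 1 (a i), Integrable f (pearsonMeasure k (b i) (∑ q, m q))) :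
    ∫ x, f x ∂(P.map fun ω => ∑ i, X i ω) = ∑ i, ∑ k ∈ Finset.Icc 1 (a i),
      Xi0 i k a b • ∫ x, f x ∂(pearsonMeasure k (b i) (∑ q, m q)) := by
  let ν (p : Σ i, Finset.Icc 1 (a i)) : Measure ℝ := pearsonMeasure p.2 (b p.1) (∑ q, m q)
  have hprob p : IsProbabilityMeasure (ν p) := isProbabilityMeasure_pearsonMeasure
    (Nat.cast_pos.2 (Finset.mem_Icc.1 p.2.2).1) (hb0 p.1) _
  have := hindep.isProbabilityMeasure
  have hcharFun : ∀ t, charFun (P.map fun ω => ∑ i, X i ω) t =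
      ∑ p, (Xi0 p.1 p.2 a b : ℂ) * charFun (ν p) t := fun t => by
    rw [charFun_map_sum_eq_sum_Xi0 ha hb hb0 hX hindep, Fintype.sum_sigma]
    exact Finset.sum_congr rfl fun i _ => (Finset.sum_coe_sort (Finset.Icc 1 (a i)) fun k =>
      (Xi0 i k a b : ℂ) * charFun (pearsonMeasure k (b i) (∑ q, m q)) t).symm
  rw [integral_eq_sum_smul_of_charFun_eq hcharFun fun p => hf p.1 p.2 p.2.2, Fintype.sum_sigma]
  exact Finset.sum_congr rfl fun i _ => Finset.sum_coe_sort (Finset.Icc 1 (a i)) fun k =>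
    Xi0 i k a b • ∫ x, f x ∂(pearsonMeasure k (b i) (∑ q, m q))

lemma measureReal_Iic_map_sum_eq_sum_Xi0 (ha : ∀ i, 0 < a i) (hb : Function.Injective b)
    (hb0 : ∀ i, b i ≠ 0) (hX : ∀ i, HasLaw (X i) (pearsonMeasure (a i) (b i) (m i)) P)
    (hindep : iIndepFun X P) (x : ℝ) :
    (P.map fun ω => ∑ i, X i ω).real (Iic x) = ∑ i, ∑ k ∈ Finset.Icc 1 (a i),
      Xi0 i k a b * pearsonCDF k (b i) (∑ q, m q) x := by
  have hpos : ∀ i, ∀ k ∈ Finset.Icc 1 (a i), (0 : ℝ) < k := fun i k hk =>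
    Nat.cast_pos.2 (Finset.mem_Icc.1 hk).1
  rw [← integral_indicator_one measurableSet_Iic,
    integral_map_sum_eq_sum_Xi0_smul ha hb hb0 hX hindep fun i k hk => ?_]
  · refine Finset.sum_congr rfl fun i _ => Finset.sum_congr rfl fun k hk => ?_
    rw [integral_indicator_one measurableSet_Iic,
      measureReal_Iic_pearsonMeasure (hpos i k hk) (hb0 i), smul_eq_mul]
  · have := isProbabilityMeasure_pearsonMeasure (hpos i k hk) (hb0 i) (∑ q, m q)
    exact (integrable_const (1 : ℝ)).indicator measurableSet_Iic

lemma integral_sum_pow_eq_sum_Xi0 (ha : ∀ i, 0 < a i) (hb : Function.Injective b)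
    (hb0 : ∀ i, b i ≠ 0) (hX : ∀ i, HasLaw (X i) (pearsonMeasure (a i) (b i) (m i)) P)
    (hindep : iIndepFun X P) (n : ℕ) :
    ∫ ω, (∑ i, X i ω) ^ n ∂P = ∑ i, ∑ k ∈ Finset.Icc 1 (a i),
      Xi0 i k a b * pearsonMoment n k (b i) (∑ q, m q) := by
  have hpos : ∀ i, ∀ k ∈ Finset.Icc 1 (a i), (0 : ℝ) < k := fun i k hk =>
    Nat.cast_pos.2 (Finset.mem_Icc.1 hk).1
  rw [← integral_map (f := fun x : ℝ => x ^ n)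
      (Finset.aemeasurable_fun_sum _ fun i _ => (hX i).aemeasurable) (by fun_prop),
    integral_map_sum_eq_sum_Xi0_smul ha hb hb0 hX hindep fun i k hk => ?_]
  · refine Finset.sum_congr rfl fun i _ => Finset.sum_congr rfl fun k hk => ?_
    rw [integral_pow_pearsonMeasure (hpos i k hk) (hb0 i), smul_eq_mul]
  · have := isProbabilityMeasure_pearsonMeasure (hpos i k hk) (hb0 i) (∑ q, m q)
    exact integrable_pow_of_memLp (memLp_id_pearsonMeasure (hpos i k hk) (hb0 i) _ n)

end Sums

theorem mainTheorem6_general {Ω : Type*} [MeasurableSpace Ω] (P : Measure Ω)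
    (N : ℕ) (X : Fin (N + 1) → Ω → ℝ)
    (a : Fin (N + 1) → ℕ) (b m : Fin (N + 1) → ℝ)
    (ha : ∀ i, 0 < a i)
    (hb : ∀ i, b i ≠ 0)
    (hX : ∀ i, HasLaw (X i) (pearsonMeasure (a i) (b i) (m i)) P)
    (hindep : iIndepFun X P) :
    ((∀ β : ℝ, (∀ i, b i = β) → ∀ x : ℝ,
        cdf (P.map fun ω => ∑ i, X i ω) x
          = pearsonCDF ((∑ i, a i : ℕ) : ℝ) β (∑ i, m i) x) ∧
      ((∀ i j, i ≠ j → b i ≠ b j) → ∀ x : ℝ,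
        cdf (P.map fun ω => ∑ i, X i ω) x
          = ∑ i, ∑ k ∈ Finset.Icc 1 (a i),
              Xi0 i k a b * pearsonCDF (k : ℝ) (b i) (∑ q, m q) x)) ∧
    (∀ n : ℕ,
      Integrable (fun ω => (∑ i, X i ω) ^ n) P ∧
      (∀ β : ℝ, (∀ i, b i = β) →
        ∫ ω, (∑ i, X i ω) ^ n ∂P
          = pearsonMoment n ((∑ i, a i : ℕ) : ℝ) β (∑ i, m i)) ∧
      ((∀ i j, i ≠ j → b i ≠ b j) →
        ∫ ω, (∑ i, X i ω) ^ n ∂P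
          = ∑ i, ∑ k ∈ Finset.Icc 1 (a i),
              Xi0 i k a b * pearsonMoment n (k : ℝ) (b i) (∑ q, m q))) := by
  have ha' : ∀ i, (0 : ℝ) < a i := fun i => Nat.cast_pos.2 (ha i)
  have hsum : (0 : ℝ) < (∑ i, a i : ℕ) :=
    Nat.cast_pos.2 (Finset.sum_pos (fun i _ => ha i) Finset.univ_nonempty)
  have hlaw : ∀ β, (∀ i, b i = β) → HasLaw (fun ω => ∑ i, X i ω)
      (pearsonMeasure (∑ i, a i : ℕ) β (∑ i, m i)) P := fun β hβ => by
    rw [Nat.cast_sum]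
    exact hasLaw_sum_pearsonMeasure ha' (hβ 0 ▸ hb 0) (fun i => hβ i ▸ hX i) hindep
  have hinj : (∀ i j, i ≠ j → b i ≠ b j) → Function.Injective b := fun h i j =>
    not_imp_not.1 (h i j)
  have := hindep.isProbabilityMeasure
  have hmem := memLp_sum_of_hasLaw_pearsonMeasure ha' hb hX
  have := Measure.isProbabilityMeasure_map (hmem 0).aemeasurable
  refine ⟨⟨fun β hβ x => ?_, fun hne x => ?_⟩, fun n => ⟨?_, fun β hβ => ?_, fun hne => ?_⟩⟩
  · rw [cdf_eq_real, (hlaw β hβ).map_eq, measureReal_Iic_pearsonMeasure hsum (hβ 0 ▸ hb 0)]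
  · rw [cdf_eq_real, measureReal_Iic_map_sum_eq_sum_Xi0 ha (hinj hne) hb hX hindep]
  · exact integrable_pow_of_memLp (hmem n)
  · rw [← integral_pow_pearsonMeasure hsum (hβ 0 ▸ hb 0)]
    exact (hlaw β hβ).integral_comp (f := fun x : ℝ => x ^ n) (by fun_prop)
  · exact integral_sum_pow_eq_sum_Xi0 ha (hinj hne) hb hX hindep n

/-- CDF and moments of a sum of `L = N + 1` independent Pearson type III random variables with
positive integer shapes and inverse scales of a common sign. -/
theorem mainTheorem6 {Ω : Type*} [MeasurableSpace Ω] (P : Measure Ω) [IsProbabilityMeasure P]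
    (N : ℕ) (X : Fin (N + 1) → Ω → ℝ)
    (a : Fin (N + 1) → ℕ) (b m : Fin (N + 1) → ℝ)
    (ha : ∀ i, 0 < a i)
    (hb : (∀ i, 0 < b i) ∨ (∀ i, b i < 0))
    (hX : ∀ i, HasLaw (X i) (pearsonMeasure (a i) (b i) (m i)) P)
    (hindep : iIndepFun X P) :
    -- the cumulative distribution function
    ((∀ β : ℝ, (∀ i, b i = β) → ∀ x : ℝ,
        cdf (P.map fun ω => ∑ i, X i ω) x
          = pearsonCDF ((∑ i, a i : ℕ) : ℝ) β (∑ i, m i) x) ∧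
      ((∀ i j, i ≠ j → b i ≠ b j) → ∀ x : ℝ,
        cdf (P.map fun ω => ∑ i, X i ω) x
          = ∑ i, ∑ k ∈ Finset.Icc 1 (a i),
              Xi0 i k a b * pearsonCDF (k : ℝ) (b i) (∑ q, m q) x)) ∧
    -- the moments
    (∀ n : ℕ,
      Integrable (fun ω => (∑ i, X i ω) ^ n) P ∧
      (∀ β : ℝ, (∀ i, b i = β) →
        ∫ ω, (∑ i, X i ω) ^ n ∂P
          = pearsonMoment n ((∑ i, a i : ℕ) : ℝ) β (∑ i, m i)) ∧
      ((∀ i j, i ≠ j → b i ≠ b j) →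
        ∫ ω, (∑ i, X i ω) ^ n ∂P
          = ∑ i, ∑ k ∈ Finset.Icc 1 (a i),
              Xi0 i k a b * pearsonMoment n (k : ℝ) (b i) (∑ q, m q))) := by
  exact mainTheorem6_general P N X a b m ha
    (fun i => hb.elim (fun h => (h i).ne') fun h => (h i).ne) hX hindep
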